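/- Let $\Sigma$ be a finite alphabet. A \emph{tree} is a finite poset $(A,\leq)$ with a unique minimal element such that any two elements having a common upper bound are comparable. A $\Sigma$-tree is a tree together with a labelling $f : A \to \Sigma$, and a $\Sigma$-word is a $\Sigma$-tree whose underlying poset is a linear order. A $\Sigma$-tree is viewed as a structure over the vocabulary $\{\leq\} \cup \{Q_a \mid a \in \Sigma\}$, where $\leq$ is interpreted by the order and the unary predicate $Q_a$ by $f^{-1}(a)$. Let $\mathrm{Words}(\Sigma)$ and $\mathrm{Trees}(\Sigma)$ be the isomorphism-closed classes of structures given by all $\Sigma$-words and by all $\Sigma$-trees, respectively. For a class $\mathcal{S}$ of structures over a vocabulary $\tau$ and $k \in \mathbb{N}$, let $\mathcal{S}_k$ be the class of all structures over $\tau$ extended by $k$ new constant symbols whose $\tau$-reducts lie in $\mathcal{S}$. The property $\mathcal{P}_{wqo}(\mathcal{S},k)$ says that $\mathcal{S}_k$ is well-quasi-ordered under isomorphic embedding $\hookrightarrow$: for every infinite sequence $\mathfrak{A}_1, \mathfrak{A}_2, \ldots$ in $\mathcal{S}_k$ there are $i < j$ such that $\mathfrak{A}_i$ is isomorphic to a substructure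 of $\mathfrak{A}_j$. \textbf{Proposition.} For every finite alphabet $\Sigma$ and every $k \in \mathbb{N}$ (including $k=0$), both $\mathcal{P}_{wqo}(\mathrm{Words}(\Sigma),k)$ and $\mathcal{P}_{wqo}(\mathrm{Trees}(\Sigma),k)$ hold. -/

import Mathlib

open FirstOrder CategoryTheory

universe u w

/-! ### The property `P_wqo(S, k)` for a class `S` of structures -/

/-- For a class `S` of `L`-structures, the class `S_k` of all structures over `L` with `k` new
constant symbols whose `L`-reducts belong to `S`. -/
def constantExpansions {L : FirstOrder.Language} (S : Set (Bundled L.Structure)) (k : ℕ) :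
    Set (Bundled (L[[Fin k]]).Structure) :=
  {M | Bundled.mk (c := L.Structure) M ((L.lhomWithConstants (Fin k)).reduct M) ∈ S}

/-- `M` embeds (isomorphically) in `N`. -/
def EmbedsIn {L : FirstOrder.Language} (M N : Bundled L.Structure) : Prop :=
  Nonempty (M ↪[L] N)

/-- `P_wqo(S, k)`: the class `S_k` is well-quasi-ordered under isomorphic embedding. -/
def Pwqo {L : FirstOrder.Language} (S : Set (Bundled L.Structure)) (k : ℕ) : Prop :=
  WellQuasiOrdered fun M N : constantExpansions S k => EmbedsIn M.1 N.1

/-! ### Labelled trees and words -/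

/-- A poset is a tree if it is finite, has a unique minimal element (the root), and any two
elements with a common upper bound are comparable. -/
structure IsTreePoset (A : Type*) [PartialOrder A] : Prop where
  finite : Finite A
  root : ∃! r : A, IsMin r
  comparable : ∀ a b c : A, a ≤ c → b ≤ c → a ≤ b ∨ b ≤ a

/-- A tree over the alphabet `α`: a tree poset together with a labelling of its elements. -/
structure LabelledTree (α : Type u) : Type (max u (w + 1)) where
  carrier : Type w
  [order : PartialOrder carrier]
  isTree : IsTreePoset carrier
  label : carrier → α

attribute [instance] LabelledTree.order

/-- A word over `α` is a tree over `α` whose underlying poset is a linear order. -/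
def LabelledTree.IsWord {α : Type u} (t : LabelledTree.{u, w} α) : Prop :=
  ∀ a b : t.carrier, a ≤ b ∨ b ≤ a

/-! ### Trees and words as relational structures -/

/-- The predicate symbols: a binary symbol `≤`, and a unary symbol `Q_a` for each letter `a`. -/
inductive TreeRel (α : Type u) : ℕ → Type u
  | le : TreeRel α 2
  | letter (a : α) : TreeRel α 1

/-- The relational vocabulary `{≤} ∪ {Q_a | a ∈ α}`. -/
def treeLanguage (α : Type u) : FirstOrder.Language.{0, u} :=
  ⟨fun _ => Empty, TreeRel α⟩

/-- The structure representing a labelled tree: `≤` is the order of the tree and `Q_a` is the set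
of all elements labelled `a`. -/
def LabelledTree.toStructure {α : Type u} (t : LabelledTree.{u, w} α) :
    Bundled.{w} (treeLanguage α).Structure where
  α := t.carrier
  str :=
    { funMap := fun f => f.elim
      RelMap := fun r v =>
        match r, v with
        | TreeRel.le, v => v 0 ≤ v 1
        | TreeRel.letter a, v => t.label (v 0) = a }

/-- The class of structures isomorphic to a tree over `α`. -/
def treeClass (α : Type u) : Set (Bundled.{w} (treeLanguage α).Structure) :=
  {M | ∃ t : LabelledTree.{u, w} α, Nonempty (t.toStructure ≃[treeLanguage α] M)}

/-- The class of structures isomorphic to a word over `α`. -/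
def wordClass (α : Type u) : Set (Bundled.{w} (treeLanguage α).Structure) :=
  {M | ∃ t : LabelledTree.{u, w} α, t.IsWord ∧ Nonempty (t.toStructure ≃[treeLanguage α] M)}

/-!
Adjoining `k` constants to a labelled tree amounts to relabelling it over the finite alphabet
`α × Set (Fin k)`: the new label of a vertex records its letter and the constants naming it. A
label-preserving order embedding of the relabelled trees is then an embedding of the expanded
structures. Words are particular trees, so everything reduces to Kruskal's theorem for tree posets
labelled by a finite set, `wellQuasiOrdered_coneEmbeds`.

To avoid forming subtrees, Kruskal's theorem is proved for pointed trees `(t, x)`, standing for the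
cone of all vertices above `x`. The argument is that of Nash-Williams. In a bad sequence minimal for
the cardinality of the cones, the proper subcones are well-quasi-ordered
(`partiallyWellOrderedOn_of_isMinBadSeq`). By Higman's lemma so are the finite lists of them, in
particular the lists of the cones at the covers of the base vertices. Together with equality of the
root labels this yields two members of the sequence, the covers of the earlier one going injectively
to covers of the later one with an embedding of each cone. In a tree, every vertex strictly above
`x` is above exactly one cover of `x`, so these embeddings glue to one of the whole cone
(`coneEmbeds_of_sublistForall₂`), which is a contradiction.
-/

/-! ### Minimal bad sequences and lists -/

open Set.PartiallyWellOrderedOn in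
/-- The key step of Nash-Williams' argument: the elements that lie below some member of a minimal
bad sequence and have smaller rank than it are well-quasi-ordered. -/
theorem partiallyWellOrderedOn_of_isMinBadSeq {P : Type*} (r : P → P → Prop) [IsTrans P r]
    (rk : P → ℕ) {f : ℕ → P} (hf : IsBadSeq r Set.univ f)
    (hmin : ∀ n, IsMinBadSeq r rk Set.univ n f) :
    {q | ∃ n, r q (f n) ∧ rk q < rk (f n)}.PartiallyWellOrderedOn r := by
  rw [iff_forall_not_isBadSeq]
  rintro h ⟨hmem, hbad⟩
  choose n hn hrk using hmem
  obtain ⟨m₀, hm₀⟩ : ∃ m₀, ∀ m, n m₀ ≤ n m := by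
    obtain ⟨_, ⟨m₀, rfl⟩, h₀⟩ :=
      WellFounded.has_min Nat.lt_wfRel.wf (Set.range n) ⟨_, 0, rfl⟩
    exact ⟨m₀, fun m => not_lt.1 (h₀ _ ⟨m, rfl⟩)⟩
  -- Follow `f` up to the least index dominating a term of `h`, and continue along `h` from there.
  refine hmin (n m₀) (fun i => if i < n m₀ then f i else h (m₀ + (i - n m₀)))
    (fun i hi => (if_pos hi).symm) (by simpa using hrk m₀) ⟨fun _ => trivial, fun i j hij => ?_⟩
  by_cases hj : j < n m₀
  · simpa [hj, hij.trans hj] using hf.2 i j hij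
  by_cases hi : i < n m₀
  · simp only [hi, hj, if_true, if_false]
    exact fun hr => hf.2 i _ (hi.trans_le (hm₀ _)) (_root_.trans hr (hn _))
  · simp only [hi, hj, if_false]
    exact hbad _ _ (by omega)

/-- The pairing of entries witnessing `List.SublistForall₂`, as an injective function. -/
theorem List.SublistForall₂.exists_injOn {P : Type*} {r : P → P → Prop} {l₁ l₂ : List P}
    (h : List.SublistForall₂ r l₁ l₂) (h₁ : l₁.Nodup) (h₂ : l₂.Nodup) :
    ∃ g : P → P, (∀ a ∈ l₁, g a ∈ l₂ ∧ r a (g a)) ∧ Set.InjOn g {a | a ∈ l₁} := by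
  classical
  induction h with
  | nil => exact ⟨id, by simp, Function.injective_id.injOn⟩
  | @cons a b l₁ l₂ hab _ ih =>
    rw [List.nodup_cons] at h₁ h₂
    obtain ⟨g, hg, hinj⟩ := ih h₁.2 h₂.2
    have hne : ∀ c ∈ l₁, c ≠ a := fun c hc e => h₁.1 (e ▸ hc)
    have hgb : ∀ c ∈ l₁, g c ≠ b := fun c hc e => h₂.1 (e ▸ (hg c hc).1)
    refine ⟨Function.update g a b, ?_, ?_⟩
    · intro c hc
      rcases List.mem_cons.1 hc with rfl | hc
      · simpa using hab
      · rw [Function.update_of_ne (hne c hc)]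
        exact ⟨List.mem_cons_of_mem _ (hg c hc).1, (hg c hc).2⟩
    · intro c hc d hd hcd
      rcases List.mem_cons.1 hc with rfl | hc' <;> rcases List.mem_cons.1 hd with rfl | hd'
      · rfl
      · rw [Function.update_self, Function.update_of_ne (hne d hd')] at hcd
        exact (hgb d hd' hcd.symm).elim
      · rw [Function.update_self, Function.update_of_ne (hne c hc')] at hcd
        exact (hgb c hc' hcd).elim
      · rw [Function.update_of_ne (hne c hc'), Function.update_of_ne (hne d hd')] at hcd
        exact hinj hc' hd' hcd
  | cons_right _ ih =>
    rw [List.nodup_cons] at h₂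
    obtain ⟨g, hg, hinj⟩ := ih h₁ h₂.2
    exact ⟨g, fun a ha => ⟨List.mem_cons_of_mem _ (hg a ha).1, (hg a ha).2⟩, hinj⟩

/-! ### Pointed trees and embeddings of cones -/

/-- A labelled tree with a distinguished vertex, standing for the cone of the vertices above it. -/
abbrev PointedTree (β : Type u) : Type (max u (w + 1)) :=
  Σ t : LabelledTree.{u, w} β, t.carrier

/-- The cone of `p` embeds in the cone of `q`, respecting order and labels. The embedding is the
restriction of a total function whose values outside the cone of `p` are irrelevant, and it need
not send base vertex to base vertex. -/
def ConeEmbeds {β : Type u} (p q : PointedTree.{u, w} β) : Prop :=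
  ∃ f : p.1.carrier → q.1.carrier,
    (∀ z, p.2 ≤ z → q.2 ≤ f z ∧ q.1.label (f z) = p.1.label z) ∧
    ∀ z z', p.2 ≤ z → p.2 ≤ z' → (f z ≤ f z' ↔ z ≤ z')

instance {β : Type u} : IsPreorder (PointedTree.{u, w} β) ConeEmbeds where
  refl p := ⟨id, fun _ hz => ⟨hz, rfl⟩, fun _ _ _ _ => Iff.rfl⟩
  trans p q s := by
    rintro ⟨f, hf, hf'⟩ ⟨g, hg, hg'⟩
    exact ⟨g ∘ f, fun z hz => ⟨(hg _ (hf z hz).1).1, (hg _ (hf z hz).1).2.trans (hf z hz).2⟩,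
      fun z z' hz hz' => (hg' _ _ (hf z hz).1 (hf z' hz').1).trans (hf' z z' hz hz')⟩

theorem coneEmbeds_of_le {β : Type u} {t : LabelledTree.{u, w} β} {x a : t.carrier} (h : x ≤ a) :
    ConeEmbeds ⟨t, a⟩ ⟨t, x⟩ :=
  ⟨id, fun _ hz => ⟨h.trans hz, rfl⟩, fun _ _ _ _ => Iff.rfl⟩

/-- The number of vertices in the cone. -/
noncomputable def PointedTree.coneCard {β : Type u} (p : PointedTree.{u, w} β) : ℕ :=
  (Set.Ici p.2).ncard

theorem PointedTree.coneCard_lt {β : Type u} {t : LabelledTree.{u, w} β} {x a : t.carrier}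
    (h : x < a) : PointedTree.coneCard ⟨t, a⟩ < PointedTree.coneCard ⟨t, x⟩ := by
  have := t.isTree.finite
  exact Set.ncard_lt_ncard (Set.Ici_ssubset_Ici.2 h) (Set.toFinite _)

/-- The pointed trees obtained by moving the base vertex to one of its covers, enumerated without
repetition. -/
theorem exists_list_covers {β : Type u} (p : PointedTree.{u, w} β) :
    ∃ l : List (PointedTree.{u, w} β), l.Nodup ∧
      ∀ q, q ∈ l ↔ ∃ a, p.2 ⋖ a ∧ q = ⟨p.1, a⟩ := by
  have := p.1.isTree.finite
  have hfin : ((fun a => (⟨p.1, a⟩ : PointedTree.{u, w} β)) '' {a | p.2 ⋖ a}).Finite :=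
    (Set.toFinite _).image _
  refine ⟨hfin.toFinset.toList, Finset.nodup_toList _, fun q => ?_⟩
  simp [eq_comm]

theorem IsTreePoset.covBy_unique {A : Type*} [PartialOrder A] (hA : IsTreePoset A) {x a b z : A}
    (ha : x ⋖ a) (hb : x ⋖ b) (haz : a ≤ z) (hbz : b ≤ z) : a = b := by
  rcases hA.comparable a b z haz hbz with h | h
  · exact (hb.eq_or_eq ha.le h).resolve_left ha.ne'
  · exact ((ha.eq_or_eq hb.le h).resolve_left hb.ne').symm

/-- Embeddings of the cones at the covers of `p.2` into the cones at distinct covers of `q.2` glue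
to an embedding of the cone of `p`, provided the base vertices have the same label. -/
theorem coneEmbeds_of_sublistForall₂ {β : Type u} {p q : PointedTree.{u, w} β}
    {l₁ l₂ : List (PointedTree.{u, w} β)} (h₁ : l₁.Nodup) (h₂ : l₂.Nodup)
    (hl₁ : ∀ s, s ∈ l₁ ↔ ∃ a, p.2 ⋖ a ∧ s = ⟨p.1, a⟩)
    (hl₂ : ∀ s, s ∈ l₂ ↔ ∃ a, q.2 ⋖ a ∧ s = ⟨q.1, a⟩)
    (hlabel : p.1.label p.2 = q.1.label q.2) (h : List.SublistForall₂ ConeEmbeds l₁ l₂) :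
    ConeEmbeds p q := by
  classical
  obtain ⟨t, x⟩ := p
  obtain ⟨s, y⟩ := q
  dsimp only at *
  have := t.isTree.finite
  obtain ⟨g, hg, hinj⟩ := h.exists_injOn h₁ h₂
  have hmem : ∀ a, x ⋖ a → (⟨t, a⟩ : PointedTree β) ∈ l₁ := fun a ha => (hl₁ _).2 ⟨a, ha, rfl⟩
  -- `G a` is the cover of `y` assigned to the cover `a` of `x`, `F a` embeds the cone of `a` in that
  -- of `G a`, and `c z` is the cover of `x` below `z`; elsewhere their values are arbitrary.
  have hcov : ∀ a, ∃ b, x ⋖ a → y ⋖ b ∧ g ⟨t, a⟩ = ⟨s, b⟩ := fun a => by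
    by_cases ha : x ⋖ a
    · obtain ⟨b, hb⟩ := (hl₂ _).1 (hg _ (hmem a ha)).1
      exact ⟨b, fun _ => hb⟩
    · exact ⟨y, fun h => (ha h).elim⟩
  choose G hG using hcov
  have hGinj : ∀ a b, x ⋖ a → x ⋖ b → G a = G b → a = b := fun a b ha hb hab => by
    have := hinj (hmem a ha) (hmem b hb) (by rw [(hG a ha).2, (hG b hb).2, hab])
    simpa using this
  have hF : ∀ a, ∃ f : t.carrier → s.carrier, x ⋖ a →
      (∀ z, a ≤ z → G a ≤ f z ∧ s.label (f z) = t.label z) ∧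
      ∀ z z', a ≤ z → a ≤ z' → (f z ≤ f z' ↔ z ≤ z') := fun a => by
    by_cases ha : x ⋖ a
    · have := (hg _ (hmem a ha)).2
      rw [(hG a ha).2] at this
      obtain ⟨f, hf⟩ := this
      exact ⟨f, fun _ => hf⟩
    · exact ⟨fun _ => y, fun h => (ha h).elim⟩
  choose F hF using hF
  have hc : ∀ z, ∃ c, x < z → x ⋖ c ∧ c ≤ z := fun z => by
    by_cases hz : x < z
    · obtain ⟨c, hc⟩ := exists_covBy_le_of_lt hz
      exact ⟨c, fun _ => hc⟩
    · exact ⟨x, fun h => (hz h).elim⟩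
  choose c hc using hc
  have hlt : ∀ z, x ≤ z → z ≠ x → x < z := fun z hz hne => lt_of_le_of_ne hz hne.symm
  have hFc : ∀ z, x < z → G (c z) ≤ F (c z) z ∧ s.label (F (c z) z) = t.label z := fun z hz =>
    (hF _ (hc z hz).1).1 z (hc z hz).2
  refine ⟨fun z => if z = x then y else F (c z) z, fun z hz => ?_, fun z z' hz hz' => ?_⟩
  · by_cases hzx : z = x
    · simpa [hzx] using hlabel.symm
    · have hz := hlt z hz hzx
      simp only [hzx, if_false]
      exact ⟨(hG _ (hc z hz).1).1.le.trans (hFc z hz).1, (hFc z hz).2⟩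
  · dsimp only at hz hz'
    by_cases hzx : z = x
    · by_cases hzx' : z' = x
      · simp [hzx, hzx']
      · have hz' := hlt z' hz' hzx'
        simp only [hzx, hzx', if_true, if_false, hz'.le, iff_true]
        exact (hG _ (hc z' hz').1).1.le.trans (hFc z' hz').1
    have hz := hlt z hz hzx
    have hGz := (hG _ (hc z hz).1).1
    by_cases hzx' : z' = x
    · simp only [hzx, hzx', if_true, if_false, hz.not_ge, iff_false]
      exact (hGz.lt.trans_le (hFc z hz).1).not_ge
    have hz' := hlt z' hz' hzx'
    have hGz' := (hG _ (hc z' hz').1).1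
    simp only [hzx, hzx', if_false]
    by_cases hcc : c z = c z'
    · rw [hcc]
      exact (hF _ (hc z' hz').1).2 z z' (hcc ▸ (hc z hz).2) (hc z' hz').2
    -- Vertices above different covers are incomparable, in both trees.
    · refine iff_of_false (fun hle => hcc ?_) (fun hle => hcc ?_)
      · exact hGinj _ _ (hc z hz).1 (hc z' hz').1
          (s.isTree.covBy_unique hGz hGz' ((hFc z hz).1.trans hle) (hFc z' hz').1)
      · exact t.isTree.covBy_unique (hc z hz).1 (hc z' hz').1 ((hc z hz).2.trans hle)
          (hc z' hz').2

/-- **Kruskal's theorem** for finite alphabets: pointed trees are well-quasi-ordered under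
embeddings of their cones. -/
theorem wellQuasiOrdered_coneEmbeds (β : Type u) [Finite β] :
    WellQuasiOrdered (ConeEmbeds (β := β) : PointedTree.{u, w} β → _ → Prop) := by
  rw [← Set.partiallyWellOrderedOn_univ_iff,
    Set.PartiallyWellOrderedOn.iff_not_exists_isMinBadSeq PointedTree.coneCard]
  rintro ⟨f, hbad, hmin⟩
  have hsub := partiallyWellOrderedOn_of_isMinBadSeq ConeEmbeds PointedTree.coneCard hbad hmin
  have hlists := Set.PartiallyWellOrderedOn.partiallyWellOrderedOn_sublistForall₂ ConeEmbeds hsub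
  choose l hnodup hl using fun n => exists_list_covers (f n)
  obtain ⟨g, hg⟩ := (Finite.wellQuasiOrdered (Eq : β → β → Prop)).exists_monotone_subseq
    fun n => (f n).1.label (f n).2
  obtain ⟨i, j, hij, hlij⟩ := hlists.exists_lt (f := fun n => l (g n)) fun n q hq => by
    obtain ⟨a, ha, rfl⟩ := (hl _ q).1 hq
    exact ⟨g n, coneEmbeds_of_le ha.le, PointedTree.coneCard_lt ha.lt⟩
  exact hbad.2 _ _ (g.lt_iff_lt.2 hij)
    (coneEmbeds_of_sublistForall₂ (hnodup _) (hnodup _) (hl _) (hl _) (hg i j hij.le) hlij)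

/-! ### Constants as labels -/

theorem IsTreePoset.exists_forall_le {A : Type*} [PartialOrder A] (hA : IsTreePoset A) :
    ∃ r : A, ∀ z, r ≤ z := by
  have := hA.finite
  obtain ⟨r, -, hr⟩ := hA.root
  refine ⟨r, fun z => ?_⟩
  obtain ⟨m, hmz, hm⟩ := (Set.finite_univ (α := A)).exists_le_minimal (Set.mem_univ z)
  exact hr m (minimal_true.1 (by simpa using hm)) ▸ hmz

/-- The element of an expanded structure named by the `i`-th new constant. -/
def namedElement {L : FirstOrder.Language} {k : ℕ} (M : Bundled (L[[Fin k]]).Structure)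
    (i : Fin k) : M :=
  FirstOrder.Language.Structure.funMap (L := L[[Fin k]]) (L.con i) Fin.elim0

/-- The tree `t` with the label of each vertex `x` enlarged by the set of constants naming its
image `e x`. -/
def LabelledTree.withNames {α : Type u} {k : ℕ} (t : LabelledTree.{u, w} α) {M : Type w}
    (e : t.carrier → M) (c : Fin k → M) : LabelledTree.{u, w} (α × Set (Fin k)) where
  carrier := t.carrier
  isTree := t.isTree
  label x := (t.label x, {i | c i = e x})

/-- A function between expansions of tree structures is an embedding as soon as it respects the
order, the letters and the constants of the underlying trees. -/
theorem embedsIn_of_treeMap {α : Type u} {k : ℕ}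
    {M N : Bundled.{w} ((treeLanguage α)[[Fin k]]).Structure} {t s : LabelledTree.{u, w} α}
    (e : t.toStructure ≃[treeLanguage α] Bundled.mk (c := (treeLanguage α).Structure) M
      (((treeLanguage α).lhomWithConstants (Fin k)).reduct M))
    (e' : s.toStructure ≃[treeLanguage α] Bundled.mk (c := (treeLanguage α).Structure) N
      (((treeLanguage α).lhomWithConstants (Fin k)).reduct N))
    (f : t.carrier → s.carrier) (hle : ∀ x y, f x ≤ f y ↔ x ≤ y)
    (hlabel : ∀ x, s.label (f x) = t.label x)
    (hconst : ∀ i x, namedElement M i = e x → namedElement N i = e' (f x)) :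
    EmbedsIn M N := by
  have hinj : Function.Injective f := fun x y h =>
    le_antisymm ((hle x y).1 h.le) ((hle y x).1 h.ge)
  refine ⟨⟨⟨fun m => e' (f (e.symm m)), ?_⟩, ?_, ?_⟩⟩
  · exact e'.injective.comp (hinj.comp e.symm.injective)
  · intro n F v
    match n, F with
    | _, Sum.inl F => exact F.elim
    | 0, Sum.inr i =>
      have hM : FirstOrder.Language.Structure.funMap (L := (treeLanguage α)[[Fin k]])
          (Sum.inr i) v = namedElement M i := congrArg _ (Subsingleton.elim _ _)
      refine Eq.trans ?_ ((hconst i (e.symm (namedElement M i)) ?_).symm.trans ?_)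
      · exact congrArg (fun m => e' (f (e.symm m))) hM
      · exact (e.apply_symm_apply _).symm
      · exact congrArg (FirstOrder.Language.Structure.funMap (L := (treeLanguage α)[[Fin k]])
          ((treeLanguage α).con i)) (Subsingleton.elim _ _)
    | n + 1, Sum.inr c => exact PEmpty.elim c
  · intro n R v
    match n, R with
    | _, Sum.inr R => exact R.elim
    | n, Sum.inl R =>
      have h₁ := e.symm.map_rel R v
      have h₂ := e'.map_rel R (f ∘ e.symm ∘ v)
      refine h₂.trans (Iff.trans ?_ h₁)
      match n, R with
      | _, TreeRel.le => exact hle _ _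
      | _, TreeRel.letter a =>
        exact (congrArg (· = a) (hlabel _)).to_iff

theorem pwqo_treeClass (α : Type u) [Finite α] (k : ℕ) : Pwqo (treeClass.{u, w} α) k := by
  intro M
  choose t e using fun n => (M n).2
  replace e := fun n => (e n).some
  choose r hr using fun n => (t n).isTree.exists_forall_le
  obtain ⟨i, j, hij, f, hf, hf'⟩ := wellQuasiOrdered_coneEmbeds.{u, w} (α × Set (Fin k))
    fun n => ⟨(t n).withNames (e n) (namedElement (M n).1), r n⟩
  refine ⟨i, j, hij, embedsIn_of_treeMap (e i) (e j) f
    (fun x y => hf' x y (hr i x) (hr i y)) (fun x => congrArg Prod.fst (hf x (hr i x)).2)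
    fun c x hc => ?_⟩
  have hset := congrArg Prod.snd (hf x (hr i x)).2
  exact (Set.ext_iff.1 hset c).2 hc

theorem Pwqo.mono {L : FirstOrder.Language} {S T : Set (Bundled L.Structure)} {k : ℕ}
    (hT : Pwqo T k) (hST : S ⊆ T) : Pwqo S k := fun M =>
  hT fun n => ⟨(M n).1, hST (M n).2⟩

theorem mainTheorem5 (α : Type u) [Finite α] (k : ℕ) :
    Pwqo (wordClass.{u, w} α) k ∧ Pwqo (treeClass.{u, w} α) k :=
  ⟨(pwqo_treeClass α k).mono fun _ ⟨t, _, e⟩ => ⟨t, e⟩, pwqo_treeClass α k⟩
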